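/- **Setting.** Consider the situation calculus with the sorts object, action, situation and time, where time is interpreted by the real numbers with $0,1,+,-,\cdot,<$. A signature consists of finitely many object constants, finitely many relational and functional symbols of sort object or time (rigid ones, with object arguments, and fluents, with object arguments and a last situation argument), and finitely many action types $A(\vec o,\vec t)$ with object and time arguments. A formula is *uniform in $s$* if it is a first-order formula (with quantifiers over objects, times and actions) that mentions no situation term other than $s$ and does not mention $\mathrm{Poss}$; a *situation-suppressed* sentence $\phi$ is obtained from such a sentence by deleting the situation arguments, and $\phi[\sigma]$ restores $\sigma$ in their place. A *basic action theory* (BAT) $\mathcal D$ (finitely presented, over a finite set of objects) consists of * finitely many sentences uniform in the initial situation $S_0$; * one precondition axiom $\mathrm{Poss}(A(\vec o,\vec t),s)\equiv\phi_A(\vec o,\vec t,s)$ for each action type $A$; * one successor state axiom $F(\vec o,\mathrm{do}(a,s))\equiv\phi_F(\vec o,a,s)$ for each relational fluent $F$, and $f(\vec o,\mathrm{do}(a,s))=y\equiv\phi_f(\vec o,y,a,s)$ for each functional fluent $f$; * domain closure and unique name axioms for actions and for the object constants; * the foundational axioms: $\mathrm{do}(a,s)=\mathrm{do}(a',s')\supset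 a=a'\wedge s=s'$; second-order induction on situations from $S_0$ along $\mathrm{do}$; $\neg\, s\sqsubset S_0$; and $s\sqsubset\mathrm{do}(a,s')\equiv s\sqsubseteq s'$; where all $\phi_A,\phi_F,\phi_f$ are uniform in $s$ and may use arbitrary arithmetic on terms of sort time, and where the information on $S_0$ is complete: for each ground atomic formula $\psi$ uniform in $S_0$, $\mathcal D\models\psi$ or $\mathcal D\models\neg\psi$. The BAT $\mathcal D$ is *real-valued* if it has a fluent of sort time. A situation $s$ is *executable*, $\mathrm{exec}(s)$, if $\mathrm{do}(a,s')\sqsubseteq s$ implies $\mathrm{Poss}(a,s')$ for all $a,s'$. A situation-suppressed sentence $\phi$ is *reachable* in $\mathcal D$ if $\mathcal D\models\exists s.\ \mathrm{exec}(s)\wedge\phi[s]$. **Theorem.** The reachability problem for real-valued BATs is undecidable: there is no algorithm that, given (the Gödel number of) any real-valued BAT $\mathcal D$ and any situation-suppressed sentence $\phi$, decides whether $\phi$ is reachable in $\mathcal D$ (the behaviour of the algorithm on other inputs being arbitrary). There is no such algorithm even if only satisfiable real-valued BATs in which no action type has a time argument are allowed as inputs. -/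

import Mathlib

namespace SitCalc

/-! ## Language

The sorts are *object*, *time* (the real numbers), *action* and *situation*.  A signature lists the
finitely many object constants, the fluent and rigid symbols (each given by its number of object
arguments; the situation argument of fluents is suppressed), and the action types (each given by its
number of object arguments and its number of time arguments). -/

/-- A finite signature of the situation calculus. -/
structure Sig where
  /-- the number of object constants -/
  numObj : ℕ
  /-- arities of the relational fluents -/
  relFluents : List ℕ
  /-- arities of the rigid relation symbols -/
  relRigids : List ℕ
  /-- arities of the functional fluents of sort object -/
  objFluents : List ℕ
  /-- arities of the rigid function symbols of sort object -/
  objRigids : List ℕ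
  /-- arities of the functional fluents of sort time -/
  timeFluents : List ℕ
  /-- arities of the rigid function symbols of sort time -/
  timeRigids : List ℕ
  /-- the action types: numbers of object arguments and of time arguments -/
  actions : List (ℕ × ℕ)

/-- Situation-suppressed terms of sort object, with `n` object variables. -/
inductive ObjTerm (S : Sig) (n : ℕ) : Type
  | var (i : Fin n) : ObjTerm S n
  | const (c : Fin S.numObj) : ObjTerm S n
  | fluent (i : Fin S.objFluents.length) (args : Fin (S.objFluents.get i) → ObjTerm S n) :
      ObjTerm S n
  | rigid (i : Fin S.objRigids.length) (args : Fin (S.objRigids.get i) → ObjTerm S n) :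
      ObjTerm S n

/-- Situation-suppressed terms of sort time, with `n` object variables and `m` time variables. -/
inductive TimeTerm (S : Sig) (n m : ℕ) : Type
  | var (i : Fin m) : TimeTerm S n m
  | zero : TimeTerm S n m
  | one : TimeTerm S n m
  | add (t u : TimeTerm S n m) : TimeTerm S n m
  | sub (t u : TimeTerm S n m) : TimeTerm S n m
  | mul (t u : TimeTerm S n m) : TimeTerm S n m
  | fluent (i : Fin S.timeFluents.length) (args : Fin (S.timeFluents.get i) → ObjTerm S n) :
      TimeTerm S n m
  | rigid (i : Fin S.timeRigids.length) (args : Fin (S.timeRigids.get i) → ObjTerm S n) :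
      TimeTerm S n m

/-- Situation-suppressed terms of sort action, with `n` object variables, `m` time variables and
`k` action variables. -/
inductive ActTerm (S : Sig) (n m k : ℕ) : Type
  | var (i : Fin k) : ActTerm S n m k
  | app (A : Fin S.actions.length) (os : Fin (S.actions.get A).1 → ObjTerm S n)
      (ts : Fin (S.actions.get A).2 → TimeTerm S n m) : ActTerm S n m k

/-- Situation-suppressed first-order formulas whose free variables are among `n` object variables,
`m` time variables and `k` action variables.  Restoring one and the same situation argument `s` in
all fluents yields the formulas uniform in `s`: neither `Poss` nor any other situation term nor
quantification over situations occurs. A quantifier binds the last variable of its sort. -/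
inductive Formula (S : Sig) : ℕ → ℕ → ℕ → Type
  | falsum {n m k : ℕ} : Formula S n m k
  | relFluent {n m k : ℕ} (i : Fin S.relFluents.length)
      (args : Fin (S.relFluents.get i) → ObjTerm S n) : Formula S n m k
  | relRigid {n m k : ℕ} (i : Fin S.relRigids.length)
      (args : Fin (S.relRigids.get i) → ObjTerm S n) : Formula S n m k
  | eqObj {n m k : ℕ} (t u : ObjTerm S n) : Formula S n m k
  | eqTime {n m k : ℕ} (t u : TimeTerm S n m) : Formula S n m k
  | ltTime {n m k : ℕ} (t u : TimeTerm S n m) : Formula S n m k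
  | eqAct {n m k : ℕ} (t u : ActTerm S n m k) : Formula S n m k
  | imp {n m k : ℕ} (φ ψ : Formula S n m k) : Formula S n m k
  | allObj {n m k : ℕ} (φ : Formula S (n + 1) m k) : Formula S n m k
  | allTime {n m k : ℕ} (φ : Formula S n (m + 1) k) : Formula S n m k
  | allAct {n m k : ℕ} (φ : Formula S n m (k + 1)) : Formula S n m k

/-- Sentences: no free variables (other than the suppressed situation). -/
abbrev Sentence (S : Sig) : Type := Formula S 0 0 0

/-- The atomic formulas.  An atomic `Sentence` is ground. -/
def Formula.IsAtomic {S : Sig} {n m k : ℕ} : Formula S n m k → Prop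
  | .relFluent _ _ => True
  | .relRigid _ _ => True
  | .eqObj _ _ => True
  | .eqTime _ _ => True
  | .ltTime _ _ => True
  | .eqAct _ _ => True
  | _ => False

/-! ## Structures -/

/-- A structure for the language of the situation calculus over `S`.  The sort time is interpreted
by the real numbers. -/
structure Interp (S : Sig) where
  /-- the sort object -/
  Obj : Type
  /-- the sort action -/
  Act : Type
  /-- the sort situation -/
  Sit : Type
  const : Fin S.numObj → Obj
  action : (A : Fin S.actions.length) →
    (Fin (S.actions.get A).1 → Obj) → (Fin (S.actions.get A).2 → ℝ) → Act
  /-- the initial situation -/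
  S0 : Sit
  /-- the situation that results from doing an action in a situation -/
  doAct : Act → Sit → Sit
  poss : Act → Sit → Prop
  /-- the ordering `⊏` on situations -/
  prec : Sit → Sit → Prop
  relFluent : (i : Fin S.relFluents.length) → (Fin (S.relFluents.get i) → Obj) → Sit → Prop
  relRigid : (i : Fin S.relRigids.length) → (Fin (S.relRigids.get i) → Obj) → Prop
  objFluent : (i : Fin S.objFluents.length) → (Fin (S.objFluents.get i) → Obj) → Sit → Obj
  objRigid : (i : Fin S.objRigids.length) → (Fin (S.objRigids.get i) → Obj) → Obj
  timeFluent : (i : Fin S.timeFluents.length) → (Fin (S.timeFluents.get i) → Obj) → Sit → ℝ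
  timeRigid : (i : Fin S.timeRigids.length) → (Fin (S.timeRigids.get i) → Obj) → ℝ

/-- Value of an object term in situation `s`. -/
def ObjTerm.val {S : Sig} {n : ℕ} (M : Interp S) (s : M.Sit) (vo : Fin n → M.Obj) :
    ObjTerm S n → M.Obj
  | .var i => vo i
  | .const c => M.const c
  | .fluent i args => M.objFluent i (fun j => (args j).val M s vo) s
  | .rigid i args => M.objRigid i (fun j => (args j).val M s vo)

/-- Value of a time term in situation `s`. -/
noncomputable def TimeTerm.val {S : Sig} {n m : ℕ} (M : Interp S) (s : M.Sit)
    (vo : Fin n → M.Obj) (vt : Fin m → ℝ) : TimeTerm S n m → ℝ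
  | .var i => vt i
  | .zero => 0
  | .one => 1
  | .add t u => t.val M s vo vt + u.val M s vo vt
  | .sub t u => t.val M s vo vt - u.val M s vo vt
  | .mul t u => t.val M s vo vt * u.val M s vo vt
  | .fluent i args => M.timeFluent i (fun j => (args j).val M s vo) s
  | .rigid i args => M.timeRigid i (fun j => (args j).val M s vo)

/-- Value of an action term in situation `s`. -/
noncomputable def ActTerm.val {S : Sig} {n m k : ℕ} (M : Interp S) (s : M.Sit)
    (vo : Fin n → M.Obj) (vt : Fin m → ℝ) (va : Fin k → M.Act) : ActTerm S n m k → M.Act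
  | .var i => va i
  | .app A os ts => M.action A (fun j => (os j).val M s vo) (fun j => (ts j).val M s vo vt)

/-- `φ.Holds M s vo vt va`: the formula `φ[s]` is true in `M` under the given variable
assignments. -/
def Formula.Holds {S : Sig} (M : Interp S) (s : M.Sit) : {n m k : ℕ} → Formula S n m k →
    (Fin n → M.Obj) → (Fin m → ℝ) → (Fin k → M.Act) → Prop
  | _, _, _, .falsum, _, _, _ => False
  | _, _, _, .relFluent i args, vo, _, _ => M.relFluent i (fun j => (args j).val M s vo) s
  | _, _, _, .relRigid i args, vo, _, _ => M.relRigid i (fun j => (args j).val M s vo)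
  | _, _, _, .eqObj t u, vo, _, _ => t.val M s vo = u.val M s vo
  | _, _, _, .eqTime t u, vo, vt, _ => t.val M s vo vt = u.val M s vo vt
  | _, _, _, .ltTime t u, vo, vt, _ => t.val M s vo vt < u.val M s vo vt
  | _, _, _, .eqAct t u, vo, vt, va => t.val M s vo vt va = u.val M s vo vt va
  | _, _, _, .imp φ ψ, vo, vt, va => φ.Holds M s vo vt va → ψ.Holds M s vo vt va
  | _, _, _, .allObj φ, vo, vt, va =>
      ∀ o : M.Obj, φ.Holds M s (Fin.snoc (α := fun _ => M.Obj) vo o) vt va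
  | _, _, _, .allTime φ, vo, vt, va =>
      ∀ r : ℝ, φ.Holds M s vo (Fin.snoc (α := fun _ => ℝ) vt r) va
  | _, _, _, .allAct φ, vo, vt, va =>
      ∀ a : M.Act, φ.Holds M s vo vt (Fin.snoc (α := fun _ => M.Act) va a)

/-- Truth of a situation-suppressed sentence in a situation. -/
def Sentence.HoldsAt {S : Sig} (φ : Sentence S) (M : Interp S) (s : M.Sit) : Prop :=
  Formula.Holds M s φ Fin.elim0 Fin.elim0 Fin.elim0

/-- `s ⊑ s'`. -/
def Interp.PrecEq {S : Sig} (M : Interp S) (s s' : M.Sit) : Prop := M.prec s s' ∨ s = s'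

/-- `s` is executable: every action performed in reaching `s` is possible in the situation where it
occurred. -/
def Interp.Exec {S : Sig} (M : Interp S) (s : M.Sit) : Prop :=
  ∀ (a : M.Act) (s' : M.Sit), M.PrecEq (M.doAct a s') s → M.poss a s'

/-- The foundational, domain-independent axioms, including second-order induction on situations. -/
structure Interp.Foundational {S : Sig} (M : Interp S) : Prop where
  do_inj : ∀ a a' s s', M.doAct a s = M.doAct a' s' → a = a' ∧ s = s'
  induction : ∀ P : M.Sit → Prop, P M.S0 → (∀ a s, P s → P (M.doAct a s)) → ∀ s, P s
  not_prec_S0 : ∀ s, ¬ M.prec s M.S0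
  prec_do : ∀ a s s', M.prec s (M.doAct a s') ↔ M.PrecEq s s'

/-- Domain closure and unique names for actions. -/
structure Interp.ActionAxioms {S : Sig} (M : Interp S) : Prop where
  closure : ∀ a, ∃ A os ts, a = M.action A os ts
  distinct : ∀ A A' os ts os' ts', A ≠ A' → M.action A os ts ≠ M.action A' os' ts'
  inj : ∀ A os ts os' ts', M.action A os ts = M.action A os' ts' → os = os' ∧ ts = ts'

/-- Domain closure and unique names for objects. -/
structure Interp.ObjectAxioms {S : Sig} (M : Interp S) : Prop where
  closure : ∀ o, ∃ c, o = M.const c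
  distinct : ∀ c c', c ≠ c' → M.const c ≠ M.const c'

/-! ## Basic action theories -/

/-- The domain-specific axioms of a (finitely presented) theory of the shape of a basic action
theory over a finite set of objects. -/
structure Theory where
  sig : Sig
  /-- the description of the initial situation: sentences, read at `S0` -/
  initial : List (Sentence sig)
  /-- `Poss(A(o⃗, t⃗), s) ≡ pre A (o⃗, t⃗, s)` -/
  pre : (A : Fin sig.actions.length) →
    Formula sig (sig.actions.get A).1 (sig.actions.get A).2 0
  /-- `F(o⃗, do(a, s)) ≡ ssaRel F (o⃗, a, s)` -/
  ssaRel : (i : Fin sig.relFluents.length) → Formula sig (sig.relFluents.get i) 0 1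
  /-- `f(o⃗, do(a, s)) = y ≡ ssaObj f (o⃗, y, a, s)`, where `y` is the last object variable -/
  ssaObj : (i : Fin sig.objFluents.length) → Formula sig (sig.objFluents.get i + 1) 0 1
  /-- `f(o⃗, do(a, s)) = y ≡ ssaTime f (o⃗, y, a, s)`, where `y` is the time variable -/
  ssaTime : (i : Fin sig.timeFluents.length) → Formula sig (sig.timeFluents.get i) 1 1

/-- `M` is a model of the set of axioms `D₀ ∪ D_poss ∪ D_ssa ∪ D_ca ∪ D_co ∪ Σ` given by `D`. -/
structure Theory.IsModel (D : Theory) (M : Interp D.sig) : Prop where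
  initial : ∀ φ ∈ D.initial, φ.HoldsAt M M.S0
  pre : ∀ A os ts s,
    M.poss (M.action A os ts) s ↔ (D.pre A).Holds M s os ts Fin.elim0
  ssaRel : ∀ i os a s,
    M.relFluent i os (M.doAct a s) ↔ (D.ssaRel i).Holds M s os Fin.elim0 (fun _ => a)
  ssaObj : ∀ i os y a s, M.objFluent i os (M.doAct a s) = y ↔
    (D.ssaObj i).Holds M s (Fin.snoc (α := fun _ => M.Obj) os y) Fin.elim0 (fun _ => a)
  ssaTime : ∀ i os y a s, M.timeFluent i os (M.doAct a s) = y ↔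
    (D.ssaTime i).Holds M s os (fun _ => y) (fun _ => a)
  actions : M.ActionAxioms
  objects : M.ObjectAxioms
  foundational : M.Foundational

/-- `D` is satisfiable. -/
def Theory.Satisfiable (D : Theory) : Prop := ∃ M : Interp D.sig, D.IsModel M

/-- Complete information on the initial situation: each ground atomic formula uniform in `S0` is
entailed or refuted by `D`. -/
def Theory.CompleteInformation (D : Theory) : Prop :=
  ∀ φ : Sentence D.sig, φ.IsAtomic →
    (∀ M : Interp D.sig, D.IsModel M → φ.HoldsAt M M.S0) ∨
    (∀ M : Interp D.sig, D.IsModel M → ¬ φ.HoldsAt M M.S0)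

/-- Basic action theories (over finitely many objects, with complete information). -/
def Theory.IsBAT (D : Theory) : Prop := D.CompleteInformation

/-- `D` is real-valued if it includes a fluent of sort time. -/
def Theory.IsRealValued (D : Theory) : Prop := D.sig.timeFluents ≠ []

/-- No action type of `D` has a time argument. -/
def Theory.NoTimeArguments (D : Theory) : Prop :=
  ∀ A : Fin D.sig.actions.length, (D.sig.actions.get A).2 = 0

/-- `φ` is reachable: `D ⊨ ∃ s. exec(s) ∧ φ[s]`. -/
def Theory.Reachable (D : Theory) (φ : Sentence D.sig) : Prop :=
  ∀ M : Interp D.sig, D.IsModel M → ∃ s : M.Sit, M.Exec s ∧ φ.HoldsAt M s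

/-! ## Instances of the reachability problem as inputs of algorithms -/

/-- Gödel number of a signature. -/
def Sig.code (S : Sig) : ℕ :=
  Encodable.encode (S.numObj, S.relFluents, S.relRigids, S.objFluents, S.objRigids,
    S.timeFluents, S.timeRigids, S.actions)

/-- Gödel number of a finite sequence of numbers. -/
def seqCode {n : ℕ} (f : Fin n → ℕ) : ℕ := Encodable.encode (List.ofFn f)

/-- Gödel number of an object term. -/
def ObjTerm.code {S : Sig} {n : ℕ} : ObjTerm S n → ℕ
  | .var i => Nat.pair 0 i
  | .const c => Nat.pair 1 c
  | .fluent i args => Nat.pair 2 (Nat.pair i (seqCode fun j => (args j).code))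
  | .rigid i args => Nat.pair 3 (Nat.pair i (seqCode fun j => (args j).code))

/-- Gödel number of a time term. -/
def TimeTerm.code {S : Sig} {n m : ℕ} : TimeTerm S n m → ℕ
  | .var i => Nat.pair 0 i
  | .zero => Nat.pair 1 0
  | .one => Nat.pair 2 0
  | .add t u => Nat.pair 3 (Nat.pair t.code u.code)
  | .sub t u => Nat.pair 4 (Nat.pair t.code u.code)
  | .mul t u => Nat.pair 5 (Nat.pair t.code u.code)
  | .fluent i args => Nat.pair 6 (Nat.pair i (seqCode fun j => (args j).code))
  | .rigid i args => Nat.pair 7 (Nat.pair i (seqCode fun j => (args j).code))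

/-- Gödel number of an action term. -/
def ActTerm.code {S : Sig} {n m k : ℕ} : ActTerm S n m k → ℕ
  | .var i => Nat.pair 0 i
  | .app A os ts => Nat.pair 1 (Nat.pair A
      (Nat.pair (seqCode fun j => (os j).code) (seqCode fun j => (ts j).code)))

/-- Gödel number of a formula. -/
def Formula.code {S : Sig} : {n m k : ℕ} → Formula S n m k → ℕ
  | _, _, _, .falsum => Nat.pair 0 0
  | _, _, _, .relFluent i args => Nat.pair 1 (Nat.pair i (seqCode fun j => (args j).code))
  | _, _, _, .relRigid i args => Nat.pair 2 (Nat.pair i (seqCode fun j => (args j).code))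
  | _, _, _, .eqObj t u => Nat.pair 3 (Nat.pair t.code u.code)
  | _, _, _, .eqTime t u => Nat.pair 4 (Nat.pair t.code u.code)
  | _, _, _, .ltTime t u => Nat.pair 5 (Nat.pair t.code u.code)
  | _, _, _, .eqAct t u => Nat.pair 6 (Nat.pair t.code u.code)
  | _, _, _, .imp φ ψ => Nat.pair 7 (Nat.pair φ.code ψ.code)
  | _, _, _, .allObj φ => Nat.pair 8 φ.code
  | _, _, _, .allTime φ => Nat.pair 9 φ.code
  | _, _, _, .allAct φ => Nat.pair 10 φ.code

/-- Gödel number of a theory. -/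
def Theory.code (D : Theory) : ℕ :=
  Nat.pair D.sig.code <|
  Nat.pair (Encodable.encode (D.initial.map Formula.code)) <|
  Nat.pair (seqCode fun A => (D.pre A).code) <|
  Nat.pair (seqCode fun i => (D.ssaRel i).code) <|
  Nat.pair (seqCode fun i => (D.ssaObj i).code) (seqCode fun i => (D.ssaTime i).code)

/-- Gödel number of an instance of the reachability problem: a theory and a sentence. -/
def instanceCode (D : Theory) (φ : Sentence D.sig) : ℕ := Nat.pair D.code φ.code

/-- The reachability problem for the theories in `C` is decidable: some algorithm, given any theory
`D` in `C` and any situation-suppressed sentence `φ`, decides whether `φ` is reachable.  Its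
behaviour on other inputs is unconstrained. -/
def ReachabilityDecidable (C : Set Theory) : Prop :=
  ∃ f : ℕ → Bool, Computable f ∧
    ∀ D ∈ C, ∀ φ : Sentence D.sig, f (instanceCode D φ) = true ↔ D.Reachable φ

/-! ### The Gödel numbering is injective -/

theorem seqCode_inj {n : ℕ} {f g : Fin n → ℕ} (h : seqCode f = seqCode g) : f = g :=
  List.ofFn_injective (Encodable.encode_injective h)

theorem Sig.code_inj {S T : Sig} (h : S.code = T.code) : S = T := by
  have h' := Encodable.encode_injective h
  cases S
  cases T
  simp_all

theorem ObjTerm.code_inj {S : Sig} {n : ℕ} (t u : ObjTerm S n) (h : t.code = u.code) :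
    t = u := by
  induction t generalizing u with
  | var i => cases u <;> simp_all [ObjTerm.code, Nat.pair_eq_pair, Fin.ext_iff]
  | const c => cases u <;> simp_all [ObjTerm.code, Nat.pair_eq_pair, Fin.ext_iff]
  | fluent i args ih =>
    cases u with
    | fluent i' args' =>
      simp only [ObjTerm.code, Nat.pair_eq_pair, true_and] at h
      obtain ⟨h1, h2⟩ := h
      obtain rfl := Fin.ext h1
      have h3 := seqCode_inj h2
      congr
      funext j
      exact ih j _ (congrFun h3 j)
    | _ => simp [ObjTerm.code, Nat.pair_eq_pair] at h
  | rigid i args ih =>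
    cases u with
    | rigid i' args' =>
      simp only [ObjTerm.code, Nat.pair_eq_pair, true_and] at h
      obtain ⟨h1, h2⟩ := h
      obtain rfl := Fin.ext h1
      have h3 := seqCode_inj h2
      congr
      funext j
      exact ih j _ (congrFun h3 j)
    | _ => simp [ObjTerm.code, Nat.pair_eq_pair] at h

theorem args_inj {S : Sig} {n l : ℕ} {f g : Fin l → ObjTerm S n}
    (h : (seqCode fun j => (f j).code) = seqCode fun j => (g j).code) : f = g := by
  funext j
  exact ObjTerm.code_inj _ _ (congrFun (seqCode_inj h) j)

theorem TimeTerm.code_inj {S : Sig} {n m : ℕ} (t u : TimeTerm S n m) (h : t.code = u.code) :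
    t = u := by
  induction t generalizing u with
  | var i => cases u <;> simp_all [TimeTerm.code, Nat.pair_eq_pair, Fin.ext_iff]
  | zero => cases u <;> simp_all [TimeTerm.code, Nat.pair_eq_pair]
  | one => cases u <;> simp_all [TimeTerm.code, Nat.pair_eq_pair]
  | add t1 t2 ih1 ih2 =>
    cases u <;> simp [TimeTerm.code, Nat.pair_eq_pair] at h
    rw [ih1 _ h.1, ih2 _ h.2]
  | sub t1 t2 ih1 ih2 =>
    cases u <;> simp [TimeTerm.code, Nat.pair_eq_pair] at h
    rw [ih1 _ h.1, ih2 _ h.2]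
  | mul t1 t2 ih1 ih2 =>
    cases u <;> simp [TimeTerm.code, Nat.pair_eq_pair] at h
    rw [ih1 _ h.1, ih2 _ h.2]
  | fluent i args =>
    cases u <;> simp only [TimeTerm.code, Nat.pair_eq_pair] at h <;> try omega
    obtain ⟨-, h1, h2⟩ := h
    obtain rfl := Fin.ext h1
    rw [args_inj h2]
  | rigid i args =>
    cases u <;> simp only [TimeTerm.code, Nat.pair_eq_pair] at h <;> try omega
    obtain ⟨-, h1, h2⟩ := h
    obtain rfl := Fin.ext h1
    rw [args_inj h2]

theorem ActTerm.code_inj {S : Sig} {n m k : ℕ} (t u : ActTerm S n m k) (h : t.code = u.code) :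
    t = u := by
  cases t with
  | var i => cases u <;> simp_all [ActTerm.code, Nat.pair_eq_pair, Fin.ext_iff]
  | app A os ts =>
    cases u <;> simp only [ActTerm.code, Nat.pair_eq_pair] at h <;> try omega
    obtain ⟨-, h1, h2, h3⟩ := h
    obtain rfl := Fin.ext h1
    rw [args_inj h2]
    congr
    funext j
    exact TimeTerm.code_inj _ _ (congrFun (seqCode_inj h3) j)

theorem Formula.code_inj {S : Sig} {n m k : ℕ} (φ ψ : Formula S n m k) (h : φ.code = ψ.code) :
    φ = ψ := by
  induction φ with
  | falsum => cases ψ <;> simp_all [Formula.code, Nat.pair_eq_pair]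
  | relFluent i args =>
    cases ψ <;> simp only [Formula.code, Nat.pair_eq_pair] at h <;> try omega
    obtain ⟨-, h1, h2⟩ := h
    obtain rfl := Fin.ext h1
    rw [args_inj h2]
  | relRigid i args =>
    cases ψ <;> simp only [Formula.code, Nat.pair_eq_pair] at h <;> try omega
    obtain ⟨-, h1, h2⟩ := h
    obtain rfl := Fin.ext h1
    rw [args_inj h2]
  | eqObj t u =>
    cases ψ <;> simp [Formula.code, Nat.pair_eq_pair] at h
    rw [ObjTerm.code_inj _ _ h.1, ObjTerm.code_inj _ _ h.2]
  | eqTime t u =>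
    cases ψ <;> simp [Formula.code, Nat.pair_eq_pair] at h
    rw [TimeTerm.code_inj _ _ h.1, TimeTerm.code_inj _ _ h.2]
  | ltTime t u =>
    cases ψ <;> simp [Formula.code, Nat.pair_eq_pair] at h
    rw [TimeTerm.code_inj _ _ h.1, TimeTerm.code_inj _ _ h.2]
  | eqAct t u =>
    cases ψ <;> simp [Formula.code, Nat.pair_eq_pair] at h
    rw [ActTerm.code_inj _ _ h.1, ActTerm.code_inj _ _ h.2]
  | imp φ1 φ2 ih1 ih2 =>
    cases ψ <;> simp [Formula.code, Nat.pair_eq_pair] at h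
    rw [ih1 _ h.1, ih2 _ h.2]
  | allObj φ ih =>
    cases ψ <;> simp [Formula.code, Nat.pair_eq_pair] at h
    rw [ih _ h]
  | allTime φ ih =>
    cases ψ <;> simp [Formula.code, Nat.pair_eq_pair] at h
    rw [ih _ h]
  | allAct φ ih =>
    cases ψ <;> simp [Formula.code, Nat.pair_eq_pair] at h
    rw [ih _ h]

theorem Theory.code_inj {D E : Theory} (h : D.code = E.code) : D = E := by
  obtain ⟨S, i, p, r, o, t⟩ := D
  obtain ⟨S', i', p', r', o', t'⟩ := E
  simp only [Theory.code, Nat.pair_eq_pair] at h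
  obtain ⟨h1, h2, h3, h4, h5, h6⟩ := h
  obtain rfl := Sig.code_inj h1
  obtain rfl : i = i' := (List.map_injective_iff.2 fun _ _ => Formula.code_inj _ _)
    (Encodable.encode_injective h2)
  obtain rfl : p = p' := funext fun j => Formula.code_inj _ _ (congrFun (seqCode_inj h3) j)
  obtain rfl : r = r' := funext fun j => Formula.code_inj _ _ (congrFun (seqCode_inj h4) j)
  obtain rfl : o = o' := funext fun j => Formula.code_inj _ _ (congrFun (seqCode_inj h5) j)
  obtain rfl : t = t' := funext fun j => Formula.code_inj _ _ (congrFun (seqCode_inj h6) j)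
  rfl

theorem instanceCode_inj {D : Theory} {φ : Sentence D.sig} {E : Theory} {ψ : Sentence E.sig}
    (h : instanceCode D φ = instanceCode E ψ) : (⟨D, φ⟩ : (D : Theory) × Sentence D.sig) = ⟨E, ψ⟩ := by
  simp only [instanceCode, Nat.pair_eq_pair] at h
  obtain rfl := Theory.code_inj h.1
  rw [Formula.code_inj _ _ h.2]

end SitCalc

namespace SitCalc

/-! ## Polynomial register machines -/

/-! The halting problem reduces to reachability. Time fluents hold unbounded numbers and successor
state axioms may apply arbitrary polynomials to them, so finitely many nullary fluents can serve as
the registers of a nondeterministic machine whose instructions test a polynomial equation and assign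
polynomials. Each instruction becomes a nullary action type, its guard the precondition and its
assignment the successor state axioms. All values that occur are natural numbers, so working in the
reals costs nothing. Entailment quantifies over all models: every model contains an executable
situation for each reachable configuration (`exists_exec_of_reach`), and the standard model, whose
situations are action sequences, contains executable situations for no others (`reach_of_exec`).

A single fixed machine is universal. The big-step semantics of `Turing.ToPartrec.Code` is a finite
set of inference rules; register 0 holds a stack of claims "program `c` maps `v` to `w`", and a rule
replaces the top claim by its premises. Programs, lists and claims are coded by a polynomial pairing
function. The machine never has to invert it: it guesses the components in the other registers by
increments and checks the guess with an equality guard (`rewriteMachine_guess`). The stack can be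
emptied, that is, register 0 can become 0, exactly when the claim is true (`reach_iff_mem_eval`).

Only the initial contents of register 0 depend on the halting instance, so the map to Gödel numbers
is primitive recursive (`primrec_instanceCode_machineTheory`). Complete information holds because
all models agree on ground atoms at `S0` (`holdsAt_S0_of_isAtomic`). -/

/-- Polynomial expressions with natural coefficients in `K` registers. -/
inductive RegExpr (K : ℕ) : Type
  | reg (i : Fin K) : RegExpr K
  | const (c : ℕ) : RegExpr K
  | add (p q : RegExpr K) : RegExpr K
  | mul (p q : RegExpr K) : RegExpr K

/-- Value of an expression under given contents of the registers. -/
def RegExpr.eval {K : ℕ} (e : Fin K → ℕ) : RegExpr K → ℕ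
  | .reg i => e i
  | .const c => c
  | .add p q => p.eval e + q.eval e
  | .mul p q => p.eval e * q.eval e

/-- An instruction may be executed when the guard `lhs = rhs` holds, and then assigns to all
registers simultaneously. -/
structure Instr (K : ℕ) where
  lhs : RegExpr K
  rhs : RegExpr K
  update : Fin K → RegExpr K

/-- The guard of an instruction holds. -/
def Instr.Enabled {K : ℕ} (I : Instr K) (e : Fin K → ℕ) : Prop := I.lhs.eval e = I.rhs.eval e

/-- The contents of the registers after an instruction. -/
def Instr.apply {K : ℕ} (I : Instr K) (e : Fin K → ℕ) : Fin K → ℕ := fun j => (I.update j).eval e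

/-- One step of a nondeterministic machine given by a list of instructions. -/
def MachineStep {K : ℕ} (P : List (Instr K)) (e e' : Fin K → ℕ) : Prop :=
  ∃ I ∈ P, I.Enabled e ∧ e' = I.apply e

/-! ## Connectives and numerals -/

/-- Conjunction. -/
def Formula.and {S : Sig} {n m k : ℕ} (φ ψ : Formula S n m k) : Formula S n m k :=
  .imp (.imp φ (.imp ψ .falsum)) .falsum

/-- Conjunction of a list of formulas. -/
def Formula.conj {S : Sig} {n m k : ℕ} : List (Formula S n m k) → Formula S n m k
  | [] => .imp .falsum .falsum
  | φ :: l => φ.and (Formula.conj l)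

theorem Formula.holds_conj {S : Sig} {n m k : ℕ} (M : Interp S) (s : M.Sit)
    (l : List (Formula S n m k)) (vo : Fin n → M.Obj) (vt : Fin m → ℝ) (va : Fin k → M.Act) :
    (Formula.conj l).Holds M s vo vt va ↔ ∀ φ ∈ l, φ.Holds M s vo vt va := by
  induction l with
  | nil => simp [Formula.conj, Formula.Holds]
  | cons φ l ih => simp [Formula.conj, Formula.and, Formula.Holds, ih]

/-- The numeral of a natural number. -/
def TimeTerm.numeral {S : Sig} {n m : ℕ} : ℕ → TimeTerm S n m
  | 0 => .zero
  | c + 1 => .add (TimeTerm.numeral c) .one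

theorem TimeTerm.val_numeral {S : Sig} {n m : ℕ} (M : Interp S) (s : M.Sit) (vo : Fin n → M.Obj)
    (vt : Fin m → ℝ) (c : ℕ) : (TimeTerm.numeral c : TimeTerm S n m).val M s vo vt = c := by
  induction c with
  | zero => simp [TimeTerm.numeral, TimeTerm.val]
  | succ c ih => simp [TimeTerm.numeral, TimeTerm.val, ih]

/-- Numerals in the initial axioms are the only part of the reduction that varies with the input, so
its computability rests on this. -/
theorem TimeTerm.primrec_code_numeral {S : Sig} {n m : ℕ} :
    Primrec fun c => (TimeTerm.numeral c : TimeTerm S n m).code := by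
  have h : Primrec fun c : ℕ => Nat.rec (motive := fun _ => ℕ) (Nat.pair 1 0)
      (fun _ r => Nat.pair 3 (Nat.pair r (Nat.pair 2 0))) c :=
    Primrec.nat_rec₁ _ (Primrec₂.natPair.comp₂ (Primrec₂.const 3)
      (Primrec₂.natPair.comp₂ Primrec₂.right (Primrec₂.const _)))
  refine h.of_eq fun c => ?_
  induction c with
  | zero => rfl
  | succ c ih => simp only [TimeTerm.numeral, TimeTerm.code, ← ih]

/-! ## The basic action theory of a machine -/

/-- One object constant, a nullary fluent of sort time for each register and a nullary action type
for each instruction. -/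
def machineSig {K : ℕ} (P : List (Instr K)) : Sig where
  numObj := 1
  relFluents := []
  relRigids := []
  objFluents := []
  objRigids := []
  timeFluents := List.replicate K 0
  timeRigids := []
  actions := List.replicate P.length (0, 0)

section Machine

variable {K : ℕ} {P : List (Instr K)}

/-- The fluent of a register. -/
def regFluent (P : List (Instr K)) (i : Fin K) : Fin (machineSig P).timeFluents.length :=
  i.cast (by simp [machineSig])

/-- The register of a fluent. -/
def fluentReg (i : Fin (machineSig P).timeFluents.length) : Fin K :=
  i.cast (by simp [machineSig])

/-- The instruction of an action type. -/
def actionInstr (A : Fin (machineSig P).actions.length) : Instr K :=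
  P.get (A.cast (by simp [machineSig]))

@[simp] theorem fluentReg_regFluent (i : Fin K) : fluentReg (regFluent P i) = i := rfl

@[simp] theorem regFluent_fluentReg (i : Fin (machineSig P).timeFluents.length) :
    regFluent P (fluentReg i) = i := rfl

theorem actionInstr_mem (A : Fin (machineSig P).actions.length) : actionInstr A ∈ P :=
  List.get_mem _ _

theorem exists_actionInstr {I : Instr K} (h : I ∈ P) :
    ∃ A : Fin (machineSig P).actions.length, actionInstr A = I := by
  obtain ⟨j, rfl⟩ := List.get_of_mem h
  exact ⟨j.cast (by simp [machineSig]), rfl⟩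

theorem machineSig_time_args (A : Fin (machineSig P).actions.length) :
    ((machineSig P).actions.get A).2 = 0 :=
  congrArg Prod.snd (List.eq_of_mem_replicate
    (List.get_mem (machineSig P).actions A : _ ∈ List.replicate P.length (0, 0)))

/-- An object term, in any context. -/
def someObj (P : List (Instr K)) (n : ℕ) : ObjTerm (machineSig P) n :=
  .const (show Fin 1 from 0)

/-- The term of sort time for an expression. -/
def RegExpr.term (P : List (Instr K)) (n m : ℕ) : RegExpr K → TimeTerm (machineSig P) n m
  | .reg i => .fluent (regFluent P i) fun _ => someObj P n
  | .const c => .numeral c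
  | .add p q => .add (p.term P n m) (q.term P n m)
  | .mul p q => .mul (p.term P n m) (q.term P n m)

/-- The precondition of the action type for an instruction. -/
def instrPre (A : Fin (machineSig P).actions.length) :
    Formula (machineSig P) ((machineSig P).actions.get A).1 ((machineSig P).actions.get A).2 0 :=
  .eqTime ((actionInstr A).lhs.term P _ _) ((actionInstr A).rhs.term P _ _)

/-- The successor state axiom of the fluent for a register. -/
def regSSA (i : Fin (machineSig P).timeFluents.length) :
    Formula (machineSig P) ((machineSig P).timeFluents.get i) 1 1 :=
  Formula.conj <| List.ofFn fun A =>
    .imp (.eqAct (.var 0) (.app A (fun _ => someObj P _) fun _ => .zero))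
      (.eqTime (.var 0) (((actionInstr A).update (fluentReg i)).term P _ _))

/-- The sentence which says that a register has a given value. -/
def regEq (P : List (Instr K)) (i : Fin K) (c : ℕ) : Sentence (machineSig P) :=
  .eqTime ((RegExpr.reg i).term P 0 0) (.numeral c)

/-- The basic action theory of a machine with given initial contents of the registers. -/
def machineTheory (P : List (Instr K)) (e : Fin K → ℕ) : Theory where
  sig := machineSig P
  initial := List.ofFn fun i => regEq P i (e i)
  pre := instrPre
  ssaRel i := i.elim0
  ssaObj i := i.elim0
  ssaTime := regSSA

/-! ### Register contents in arbitrary models -/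

/-- In situation `s`, the fluents have the values `e`. -/
def HasContents (M : Interp (machineSig P)) (s : M.Sit) (e : Fin K → ℕ) : Prop :=
  ∀ i os, M.timeFluent i os s = e (fluentReg i)

/-- The cast from the naturals to the reals commutes with sums and products and is injective, so
guards and updates mean the same in both. -/
theorem HasContents.val_term {M : Interp (machineSig P)} {s : M.Sit} {e : Fin K → ℕ}
    (h : HasContents M s e) {n m : ℕ} (p : RegExpr K) (vo : Fin n → M.Obj) (vt : Fin m → ℝ) :
    (p.term P n m).val M s vo vt = p.eval e := by
  induction p with
  | reg i => simp [RegExpr.term, TimeTerm.val, RegExpr.eval, h (regFluent P i)]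
  | const c => simp [RegExpr.term, TimeTerm.val_numeral, RegExpr.eval]
  | add p q hp hq => simp [RegExpr.term, TimeTerm.val, RegExpr.eval, hp, hq]
  | mul p q hp hq => simp [RegExpr.term, TimeTerm.val, RegExpr.eval, hp, hq]

theorem HasContents.regEq_iff {M : Interp (machineSig P)} {s : M.Sit} {e : Fin K → ℕ}
    (h : HasContents M s e) (i : Fin K) (c : ℕ) : (regEq P i c).HoldsAt M s ↔ e i = c := by
  simp [Sentence.HoldsAt, regEq, Formula.Holds, h.val_term, TimeTerm.val_numeral, RegExpr.eval]

theorem HasContents.instrPre_iff {M : Interp (machineSig P)} {s : M.Sit} {e : Fin K → ℕ}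
    (h : HasContents M s e) (A : Fin (machineSig P).actions.length) (os ts va) :
    (instrPre A).Holds M s os ts va ↔ (actionInstr A).Enabled e := by
  simp [instrPre, Formula.Holds, h.val_term, Instr.Enabled]

/-- The object and the `0` passed to `M.action` are dummies: all arities are zero, but for a
variable `A` only propositionally. -/
theorem HasContents.regSSA_iff {M : Interp (machineSig P)} {s : M.Sit} {e : Fin K → ℕ}
    (h : HasContents M s e) (i : Fin (machineSig P).timeFluents.length) (os y a) :
    (regSSA i).Holds M s os (fun _ => y) (fun _ => a) ↔
      ∀ A : Fin (machineSig P).actions.length,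
        a = M.action A (fun _ => M.const (show Fin 1 from 0)) (fun _ => 0) →
          y = (actionInstr A).apply e (fluentReg i) := by
  rw [regSSA, Formula.holds_conj]
  simp only [List.forall_mem_ofFn_iff, Formula.Holds, ActTerm.val, TimeTerm.val, h.val_term]
  rfl

variable {e₀ : Fin K → ℕ}

theorem subsingleton_obj {M : Interp (machineSig P)} (h : M.ObjectAxioms) :
    Subsingleton M.Obj := by
  refine ⟨fun x y => ?_⟩
  obtain ⟨c, rfl⟩ := h.closure x
  obtain ⟨d, rfl⟩ := h.closure y
  exact congrArg M.const (Subsingleton.elim (α := Fin 1) c d)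

theorem action_eq {M : Interp (machineSig P)} (h : M.ObjectAxioms)
    (A : Fin (machineSig P).actions.length) (os os' ts ts') :
    M.action A os ts = M.action A os' ts' := by
  have := subsingleton_obj h
  have hts : ts = ts' := funext fun j => (j.cast (machineSig_time_args A)).elim0
  rw [Subsingleton.elim os os', hts]

theorem hasContents_S0 {M : Interp (machineSig P)} (h : (machineTheory P e₀).IsModel M) :
    HasContents M M.S0 e₀ := by
  intro i os
  have := subsingleton_obj h.objects
  have h1 : (regEq P (fluentReg i) (e₀ (fluentReg i))).HoldsAt M M.S0 :=
    h.initial _ (List.mem_ofFn.2 ⟨fluentReg i, rfl⟩)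
  simp only [regEq, Sentence.HoldsAt, Formula.Holds, TimeTerm.val_numeral, RegExpr.term,
    TimeTerm.val, regFluent_fluentReg] at h1
  rw [← h1]
  congr 1
  exact Subsingleton.elim _ _

theorem HasContents.poss_iff {M : Interp (machineSig P)} (hM : (machineTheory P e₀).IsModel M)
    {s : M.Sit} {e : Fin K → ℕ} (h : HasContents M s e)
    (A : Fin (machineSig P).actions.length) (os ts) :
    M.poss (M.action A os ts) s ↔ (actionInstr A).Enabled e :=
  (hM.pre A os ts s).trans (h.instrPre_iff A os ts _)

/-- By unique names, only the conjunct of the performed action type has a true antecedent, so the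
axiom fixes the new value. -/
theorem HasContents.doAct {M : Interp (machineSig P)} (hM : (machineTheory P e₀).IsModel M)
    {s : M.Sit} {e : Fin K → ℕ} (h : HasContents M s e)
    (A : Fin (machineSig P).actions.length) (os ts) :
    HasContents M (M.doAct (M.action A os ts) s) ((actionInstr A).apply e) := by
  intro i os'
  refine (hM.ssaTime i os' _ _ s).2 ((h.regSSA_iff i os' _ _).2 fun B hAB => ?_)
  obtain rfl : A = B := by
    by_contra hne
    exact hM.actions.distinct _ _ _ _ _ _ hne hAB
  rfl

end Machine

/-! ### Executable situations and reachable configurations -/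

theorem Interp.Foundational.exec_S0 {S : Sig} {M : Interp S} (h : M.Foundational) :
    M.Exec M.S0 := by
  rintro a s (hs | hs)
  · exact absurd hs (h.not_prec_S0 _)
  -- `S0` is no successor: `do(a, s) = S0` together with `s ⊏ do(a, s)` would give `s ⊏ S0`.
  · exact absurd (hs ▸ (h.prec_do a s s).2 (Or.inr rfl)) (h.not_prec_S0 s)

theorem Interp.Foundational.exec_doAct {S : Sig} {M : Interp S} (h : M.Foundational) {a : M.Act}
    {s : M.Sit} (hs : M.Exec s) (ha : M.poss a s) : M.Exec (M.doAct a s) := by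
  rintro b t (ht | ht)
  · exact hs b t ((h.prec_do _ _ _).1 ht)
  · obtain ⟨rfl, rfl⟩ := h.do_inj _ _ _ _ ht
    exact ha

section Machine

variable {K : ℕ} {P : List (Instr K)} {e₀ : Fin K → ℕ}

theorem exists_exec_of_reach {M : Interp (machineSig P)} (hM : (machineTheory P e₀).IsModel M)
    {e : Fin K → ℕ} (h : Relation.ReflTransGen (MachineStep P) e₀ e) :
    ∃ s, M.Exec s ∧ HasContents M s e := by
  induction h with
  | refl => exact ⟨M.S0, hM.foundational.exec_S0, hasContents_S0 hM⟩
  | tail _ hstep ih =>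
    obtain ⟨s, hs, hc⟩ := ih
    obtain ⟨I, hI, hen, rfl⟩ := hstep
    obtain ⟨A, rfl⟩ := exists_actionInstr hI
    exact ⟨M.doAct (M.action A (fun _ => M.const (show Fin 1 from 0)) fun _ => 0) s,
      hM.foundational.exec_doAct hs ((hc.poss_iff hM A _ _).2 hen), hc.doAct hM A _ _⟩

/-! ### The standard model -/

/-- Contents of the registers after a sequence of instructions, the latest of which comes first. -/
def contents (e₀ : Fin K → ℕ) : List (Fin (machineSig P).actions.length) → Fin K → ℕ
  | [] => e₀
  | A :: s => (actionInstr A).apply (contents e₀ s)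

/-- The standard model: situations are sequences of actions. -/
def machineModel (P : List (Instr K)) (e₀ : Fin K → ℕ) : Interp (machineSig P) where
  Obj := Unit
  Act := Fin (machineSig P).actions.length
  Sit := List (Fin (machineSig P).actions.length)
  const _ := ()
  action A _ _ := A
  S0 := []
  doAct A s := A :: s
  poss A s := (actionInstr A).Enabled (contents e₀ s)
  prec s s' := s <:+ s' ∧ s ≠ s'
  relFluent i := i.elim0
  relRigid i := i.elim0
  objFluent i := i.elim0
  objRigid i := i.elim0
  timeFluent i _ s := contents e₀ s (fluentReg i)
  timeRigid i := i.elim0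

theorem hasContents_machineModel (s : (machineModel P e₀).Sit) :
    HasContents (machineModel P e₀) s (contents e₀ s) := fun _ _ => rfl

/-- The latest action is the head of the list, so an earlier situation is a suffix. -/
theorem machineModel_precEq (s s' : (machineModel P e₀).Sit) :
    (machineModel P e₀).PrecEq s s' ↔ List.IsSuffix s s' := by
  constructor
  · rintro (h | rfl)
    · exact h.1
    · exact List.suffix_refl _
  · intro h
    by_cases hs : s = s'
    · exact Or.inr hs
    · exact Or.inl ⟨h, hs⟩

theorem machineModel_foundational (P : List (Instr K)) (e₀ : Fin K → ℕ) :
    (machineModel P e₀).Foundational where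
  do_inj a a' s s' h := List.cons_eq_cons.1 h
  induction Q h0 h s := by
    induction s with
    | nil => exact h0
    | cons a s ih => exact h a s ih
  not_prec_S0 s h := h.2 (List.suffix_nil.1 h.1)
  prec_do a s s' := by
    rw [machineModel_precEq]
    constructor
    · rintro ⟨h, hne⟩
      exact (List.suffix_cons_iff.1 h).resolve_left hne
    · intro h
      refine ⟨List.suffix_cons_iff.2 (Or.inr h), ?_⟩
      rintro rfl
      have := List.IsSuffix.length_le h
      exact absurd this (Nat.not_succ_le_self _)

theorem isModel_machineModel (P : List (Instr K)) (e₀ : Fin K → ℕ) :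
    (machineTheory P e₀).IsModel (machineModel P e₀) where
  initial φ hφ := by
    obtain ⟨i, rfl⟩ := List.mem_ofFn.1 hφ
    exact ((hasContents_machineModel _).regEq_iff i _).2 rfl
  pre A os ts s := ((hasContents_machineModel s).instrPre_iff A os ts _).symm
  ssaRel i := i.elim0
  ssaObj i := i.elim0
  ssaTime i os y a s := by
    refine Iff.trans ?_ ((hasContents_machineModel s).regSSA_iff i os y a).symm
    constructor
    · rintro rfl A hA
      obtain rfl : a = A := hA
      rfl
    · intro h
      exact (h a rfl).symm
  actions :=
    { closure := fun a => ⟨a, fun _ => (), fun _ => 0, rfl⟩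
      distinct := fun A A' _ _ _ _ h => h
      inj := fun A os ts os' ts' _ =>
        ⟨funext fun _ => rfl, funext fun j => (j.cast (machineSig_time_args A)).elim0⟩ }
  objects :=
    { closure := fun _ => ⟨(show Fin 1 from 0), rfl⟩
      distinct := fun c d h => absurd (Subsingleton.elim (α := Fin 1) c d) h }
  foundational := machineModel_foundational P e₀

theorem reach_of_exec (s : (machineModel P e₀).Sit) (hs : (machineModel P e₀).Exec s) :
    Relation.ReflTransGen (MachineStep P) e₀ (contents e₀ s) := by
  induction s with
  | nil => exact .refl
  | cons a s ih =>
    have ha : (machineModel P e₀).poss a s := hs a s (Or.inr rfl)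
    refine .tail (ih fun b t ht => hs b t ?_) ⟨_, actionInstr_mem a, ha, rfl⟩
    exact (machineModel_precEq _ _).2
      (((machineModel_precEq _ _).1 ht).trans (List.suffix_cons a s))

/-- Left to right, the standard model alone suffices; right to left, the run is replayed in an
arbitrary model. -/
theorem machineTheory_reachable_iff (i : Fin K) :
    (machineTheory P e₀).Reachable (regEq P i 0) ↔
      ∃ e, Relation.ReflTransGen (MachineStep P) e₀ e ∧ e i = 0 := by
  constructor
  · intro h
    obtain ⟨s, hs, hφ⟩ := h _ (isModel_machineModel P e₀)
    exact ⟨_, reach_of_exec s hs, ((hasContents_machineModel s).regEq_iff i 0).1 hφ⟩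
  · rintro ⟨e, he, h0⟩ M hM
    obtain ⟨s, hs, hc⟩ := exists_exec_of_reach hM he
    exact ⟨s, hs, (hc.regEq_iff i 0).2 h0⟩

/-! ### Complete information -/

theorem val_S0_eq {M M' : Interp (machineSig P)} (hM : (machineTheory P e₀).IsModel M)
    (hM' : (machineTheory P e₀).IsModel M') (t : TimeTerm (machineSig P) 0 0) :
    t.val M M.S0 Fin.elim0 Fin.elim0 = t.val M' M'.S0 Fin.elim0 Fin.elim0 := by
  induction t with
  | var i => exact i.elim0
  | zero => rfl
  | one => rfl
  | add t u ht hu => simp only [TimeTerm.val, ht, hu]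
  | sub t u ht hu => simp only [TimeTerm.val, ht, hu]
  | mul t u ht hu => simp only [TimeTerm.val, ht, hu]
  | fluent i args =>
    simp only [TimeTerm.val]
    rw [hasContents_S0 hM, hasContents_S0 hM']
  | rigid i args => exact i.elim0

/-- Ground time terms have the same value at `S0` in all models, there is only one object, and two
ground actions are equal exactly when their types are. Complete information then follows by
consulting the standard model. -/
theorem holdsAt_S0_of_isAtomic {M M' : Interp (machineSig P)}
    (hM : (machineTheory P e₀).IsModel M) (hM' : (machineTheory P e₀).IsModel M')
    (φ : Sentence (machineSig P)) (hφ : φ.IsAtomic) (h : φ.HoldsAt M M.S0) :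
    φ.HoldsAt M' M'.S0 := by
  unfold Sentence.HoldsAt at *
  cases φ with
  | relFluent i => exact i.elim0
  | relRigid i => exact i.elim0
  | eqObj t u => exact (subsingleton_obj hM'.objects).elim _ _
  | eqTime t u => simpa only [Formula.Holds, val_S0_eq hM hM'] using h
  | ltTime t u => simpa only [Formula.Holds, val_S0_eq hM hM'] using h
  | eqAct t u =>
    cases t with
    | var i => exact i.elim0
    | app A os ts =>
      cases u with
      | var i => exact i.elim0
      | app B os' ts' =>
        obtain rfl : A = B := by
          by_contra hne
          exact hM.actions.distinct _ _ _ _ _ _ hne h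
        exact action_eq hM'.objects _ _ _ _ _
  | _ => exact hφ.elim

theorem machineTheory_isBAT (P : List (Instr K)) (e₀ : Fin K → ℕ) :
    (machineTheory P e₀).IsBAT := by
  intro φ hφ
  by_cases h : φ.HoldsAt (machineModel P e₀) (machineModel P e₀).S0
  · exact Or.inl fun M hM => holdsAt_S0_of_isAtomic (isModel_machineModel P e₀) hM φ hφ h
  · exact Or.inr fun M hM hφM =>
      h (holdsAt_S0_of_isAtomic hM (isModel_machineModel P e₀) φ hφ hφM)

end Machine

/-! ### Gödel numbers -/

theorem primrec_instanceCode_machineTheory {K : ℕ} (P : List (Instr K)) (i : Fin K)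
    {e : ℕ → Fin K → ℕ} (he : ∀ j, Primrec fun c => e c j) :
    Primrec fun c => instanceCode (machineTheory P (e c)) (regEq P i 0) := by
  have h : Primrec fun c => Encodable.encode (List.ofFn fun j => (regEq P j (e c j)).code) :=
    -- 4 is the tag of `eqTime` in `Formula.code`.
    Primrec.encode.comp (Primrec.list_ofFn fun j => Primrec₂.natPair.comp (Primrec.const 4)
      (Primrec₂.natPair.comp (Primrec.const _) (TimeTerm.primrec_code_numeral.comp (he j))))
  -- Any instance would do: apart from the initial axioms the theory does not depend on `e`.
  let T := machineTheory P (e 0)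
  refine (Primrec₂.natPair.comp (Primrec₂.natPair.comp (Primrec.const T.sig.code)
    (Primrec₂.natPair.comp h (Primrec.const
      (Nat.pair (seqCode fun A => (T.pre A).code) <| Nat.pair (seqCode fun i => (T.ssaRel i).code) <|
        Nat.pair (seqCode fun i => (T.ssaObj i).code) (seqCode fun i => (T.ssaTime i).code)))))
    (Primrec.const (regEq P i 0).code)).of_eq fun c => ?_
  have hc : (List.ofFn fun j => (regEq P j (e c j)).code) =
      (List.ofFn fun j => regEq P j (e c j)).map Formula.code := by
    rw [List.map_ofFn]
    rfl
  rw [hc]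
  rfl


/-! ## Rewriting one register with guesses in the others -/

/-- The instruction which replaces the value `r.1` of register `0` by the value of `r.2`. -/
def rewriteInstr {K : ℕ} (r : RegExpr (K + 1) × RegExpr (K + 1)) : Instr (K + 1) where
  lhs := .reg 0
  rhs := r.1
  update := Fin.cons r.2 fun j => .reg j.succ

/-- The instruction which sets all registers but register `0` to `0`. -/
def resetInstr (K : ℕ) : Instr (K + 1) where
  lhs := .const 0
  rhs := .const 0
  update := Fin.cons (.reg 0) fun _ => .const 0

/-- The instruction which increments register `j + 1`. -/
def incInstr {K : ℕ} (j : Fin K) : Instr (K + 1) where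
  lhs := .const 0
  rhs := .const 0
  update := Function.update .reg j.succ (.add (.reg j.succ) (.const 1))

/-- The machine which rewrites register `0` by rules with parameters in the other registers. -/
def rewriteMachine {K : ℕ} (R : List (RegExpr (K + 1) × RegExpr (K + 1))) : List (Instr (K + 1)) :=
  resetInstr K :: (List.ofFn incInstr ++ R.map rewriteInstr)

/-- One rewriting step. -/
def RewriteStep {K : ℕ} (R : List (RegExpr (K + 1) × RegExpr (K + 1))) (x y : ℕ) : Prop :=
  ∃ r ∈ R, ∃ e : Fin (K + 1) → ℕ, e 0 = x ∧ r.1.eval e = x ∧ r.2.eval e = y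

section Rewrite

variable {K : ℕ} {R : List (RegExpr (K + 1) × RegExpr (K + 1))}

theorem incInstr_apply (j : Fin K) (e : Fin (K + 1) → ℕ) :
    (incInstr j).apply e = Function.update e j.succ (e j.succ + 1) := by
  funext k
  by_cases hk : k = j.succ
  · subst hk
    simp [Instr.apply, incInstr, RegExpr.eval]
  · simp [Instr.apply, incInstr, RegExpr.eval, hk]

theorem resetInstr_apply (e : Fin (K + 1) → ℕ) :
    (resetInstr K).apply e = Fin.cons (e 0) fun _ => 0 := by
  funext k
  cases k using Fin.cases <;> simp [Instr.apply, resetInstr, RegExpr.eval]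

/-- Reset the parameters, then increment them one at a time up to their targets; the induction is on
the sum of the targets. This supplies existential guesses without action arguments. -/
theorem rewriteMachine_guess (e e' : Fin (K + 1) → ℕ) (h : e 0 = e' 0) :
    Relation.ReflTransGen (MachineStep (rewriteMachine R)) e e' := by
  obtain ⟨c, hc⟩ : ∃ c, ∑ j : Fin K, e' j.succ = c := ⟨_, rfl⟩
  induction c generalizing e' with
  | zero =>
    refine .single ⟨resetInstr K, by simp [rewriteMachine], rfl, ?_⟩
    rw [resetInstr_apply]
    funext k
    cases k using Fin.cases with
    | zero => exact h.symm
    | succ j => exact Finset.sum_eq_zero_iff.1 hc j (Finset.mem_univ j)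
  | succ c ih =>
    obtain ⟨j, hj⟩ : ∃ j : Fin K, e' j.succ ≠ 0 := by
      by_contra! h0
      simp [h0] at hc
    have hsum : ∑ k : Fin K, Function.update e' j.succ (e' j.succ - 1) k.succ = c := by
      rw [← Finset.add_sum_erase _ _ (Finset.mem_univ j)] at hc ⊢
      have : ∑ k ∈ Finset.univ.erase j, Function.update e' j.succ (e' j.succ - 1) k.succ =
          ∑ k ∈ Finset.univ.erase j, e' k.succ :=
        Finset.sum_congr rfl fun k hk => Function.update_of_ne
          (fun hkj => (Finset.mem_erase.1 hk).1 (Fin.succ_injective _ hkj)) _ _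
      rw [this, Function.update_self]
      omega
    -- The last step of the run increments register `j + 1`, so the induction hypothesis is applied
    -- to the target with that register lowered by one.
    refine .tail (ih (Function.update e' j.succ (e' j.succ - 1)) ?_ hsum)
      ⟨incInstr j, by simp [rewriteMachine], rfl, ?_⟩
    · rw [Function.update_of_ne (Fin.succ_ne_zero j).symm, h]
    · rw [incInstr_apply, Function.update_self, Function.update_idem, Nat.sub_one_add_one hj,
        Function.update_eq_self]

theorem rewriteMachine_step {e e' : Fin (K + 1) → ℕ} (h : MachineStep (rewriteMachine R) e e') :
    e' 0 = e 0 ∨ RewriteStep R (e 0) (e' 0) := by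
  obtain ⟨I, hI, hen, rfl⟩ := h
  simp only [rewriteMachine, List.mem_cons, List.mem_append, List.mem_ofFn, List.mem_map] at hI
  rcases hI with rfl | ⟨j, rfl⟩ | ⟨r, hr, rfl⟩
  · exact Or.inl rfl
  · left
    rw [incInstr_apply, Function.update_of_ne (Fin.succ_ne_zero j).symm]
  · exact Or.inr ⟨r, hr, e, rfl, Eq.symm hen, rfl⟩

theorem rewriteMachine_reach_iff (e : Fin (K + 1) → ℕ) (y : ℕ) :
    (∃ e', Relation.ReflTransGen (MachineStep (rewriteMachine R)) e e' ∧ e' 0 = y) ↔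
      Relation.ReflTransGen (RewriteStep R) (e 0) y := by
  constructor
  · rintro ⟨e', he, rfl⟩
    induction he with
    | refl => exact .refl
    | tail _ h ih =>
      rcases rewriteMachine_step h with h | h
      · rwa [h]
      · exact ih.tail h
  · intro h
    induction h with
    | refl => exact ⟨e, .refl, rfl⟩
    | tail _ h ih =>
      obtain ⟨e', he', rfl⟩ := ih
      obtain ⟨r, hr, g, hg, hr1, rfl⟩ := h
      exact ⟨(rewriteInstr r).apply g, (he'.trans (rewriteMachine_guess e' g hg.symm)).tail
        ⟨rewriteInstr r, List.mem_cons_of_mem _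
          (List.mem_append_right _ (List.mem_map_of_mem hr)), hg.trans hr1.symm, rfl⟩, rfl⟩

end Rewrite

/-! ## Encodings by polynomials -/

/-- A polynomial pairing function. -/
def polyPair (a b : ℕ) : ℕ := (a + b) * (a + b) + a

/-- A left inverse of `polyPair`. -/
def polyUnpair (c : ℕ) : ℕ × ℕ :=
  (c - c.sqrt * c.sqrt, c.sqrt - (c - c.sqrt * c.sqrt))

-- Since `a ≤ 2 * (a + b)`, the number `(a + b)² + a` lies below the next square, and its integer
-- square root is `a + b`.
@[simp] theorem polyUnpair_polyPair (a b : ℕ) : polyUnpair (polyPair a b) = (a, b) := by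
  have h : (polyPair a b).sqrt = a + b := Nat.sqrt_add_eq _ (by omega)
  rw [polyUnpair, h, polyPair]
  ext <;> simp

theorem polyUnpair_fst_le (c : ℕ) : (polyUnpair c).1 ≤ c := Nat.sub_le _ _

theorem polyUnpair_snd_le (c : ℕ) : (polyUnpair c).2 ≤ c :=
  (Nat.sub_le _ _).trans (Nat.sqrt_le_self c)

/-- The code of a nonempty list. -/
def polyCons (a l : ℕ) : ℕ := polyPair a l + 1

/-- Code of a list of numbers. -/
def encodeList : List ℕ → ℕ
  | [] => 0
  | a :: l => polyCons a (encodeList l)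

/-- Decoding of lists. -/
def decodeList : ℕ → List ℕ
  | 0 => []
  | c + 1 => (polyUnpair c).1 :: decodeList (polyUnpair c).2
  decreasing_by exact Nat.lt_succ_of_le (polyUnpair_snd_le c)

@[simp] theorem decodeList_zero : decodeList 0 = [] := by rw [decodeList]

@[simp] theorem decodeList_polyCons (a l : ℕ) : decodeList (polyCons a l) = a :: decodeList l := by
  rw [polyCons, decodeList, polyUnpair_polyPair]

@[simp] theorem decodeList_encodeList (l : List ℕ) : decodeList (encodeList l) = l := by
  induction l with
  | nil => simp [encodeList]
  | cons a l ih => simp [encodeList, ih]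

open Turing.ToPartrec

/-- Code of a program. -/
def encodeCode : Code → ℕ
  | .zero' => 0
  | .succ => 1
  | .tail => 2
  -- The offsets 3, 4, 5, 6 are distinct modulo 4 and avoid the codes 0, 1, 2 of the atomic
  -- programs.
  | .cons f g => 4 * polyPair (encodeCode f) (encodeCode g) + 3
  | .comp f g => 4 * polyPair (encodeCode f) (encodeCode g) + 4
  | .case f g => 4 * polyPair (encodeCode f) (encodeCode g) + 5
  | .fix f => 4 * encodeCode f + 6

/-- Decoding of programs. -/
def decodeCode : ℕ → Code
  | 0 => .zero'
  | 1 => .succ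
  | 2 => .tail
  | c + 3 =>
    have h1 := polyUnpair_fst_le (c / 4)
    have h2 := polyUnpair_snd_le (c / 4)
    if c % 4 = 0 then
      .cons (decodeCode (polyUnpair (c / 4)).1) (decodeCode (polyUnpair (c / 4)).2)
    else if c % 4 = 1 then
      .comp (decodeCode (polyUnpair (c / 4)).1) (decodeCode (polyUnpair (c / 4)).2)
    else if c % 4 = 2 then
      .case (decodeCode (polyUnpair (c / 4)).1) (decodeCode (polyUnpair (c / 4)).2)
    else .fix (decodeCode (c / 4))
  decreasing_by all_goals omega

@[simp] theorem decodeCode_zero : decodeCode 0 = .zero' := by rw [decodeCode]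

@[simp] theorem decodeCode_one : decodeCode 1 = .succ := by rw [decodeCode]

@[simp] theorem decodeCode_two : decodeCode 2 = .tail := by rw [decodeCode]

@[simp] theorem decodeCode_cons (f g : ℕ) :
    decodeCode (4 * polyPair f g + 3) = .cons (decodeCode f) (decodeCode g) := by
  rw [decodeCode]
  simp

@[simp] theorem decodeCode_comp (f g : ℕ) :
    decodeCode (4 * polyPair f g + 4) = .comp (decodeCode f) (decodeCode g) := by
  have h : (4 * polyPair f g + 1) / 4 = polyPair f g := by omega
  have h' : (4 * polyPair f g + 1) % 4 = 1 := by omega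
  rw [decodeCode]
  simp [h, h']

@[simp] theorem decodeCode_case (f g : ℕ) :
    decodeCode (4 * polyPair f g + 5) = .case (decodeCode f) (decodeCode g) := by
  have h : (4 * polyPair f g + 2) / 4 = polyPair f g := by omega
  have h' : (4 * polyPair f g + 2) % 4 = 2 := by omega
  rw [decodeCode]
  simp [h, h']

@[simp] theorem decodeCode_fix (f : ℕ) : decodeCode (4 * f + 6) = .fix (decodeCode f) := by
  have h : (4 * f + 3) / 4 = f := by omega
  have h' : (4 * f + 3) % 4 = 3 := by omega
  rw [decodeCode]
  simp [h, h']

@[simp] theorem decodeCode_encodeCode (c : Code) : decodeCode (encodeCode c) = c := by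
  induction c <;> simp_all [encodeCode]

/-! ## The semantics of programs as a system of rules -/

theorem mem_eval_cons {f g : Code} {v w : List ℕ} :
    w ∈ (Code.cons f g).eval v ↔
      ∃ u ∈ f.eval v, ∃ u' ∈ g.eval v, w = u.headI :: u' := by
  simp [Part.mem_bind_iff]

theorem mem_eval_comp {f g : Code} {v w : List ℕ} :
    w ∈ (Code.comp f g).eval v ↔ ∃ u ∈ g.eval v, w ∈ f.eval u := by
  rw [Code.comp_eval]
  exact Part.mem_bind_iff.trans (by simp)

/-- One unfolding of the loop: the head of the body's output decides between stopping and iterating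
on the tail. -/
theorem mem_eval_fix {f : Code} {v w : List ℕ} :
    w ∈ (Code.fix f).eval v ↔ ∃ u ∈ f.eval v,
      (u.headI = 0 ∧ w = u.tail) ∨ (u.headI ≠ 0 ∧ w ∈ (Code.fix f).eval u.tail) := by
  rw [Code.fix_eval]
  refine PFun.mem_fix_iff.trans ?_
  simp only [Part.mem_map_iff]
  constructor
  · rintro (⟨u, hu, h⟩ | ⟨u', ⟨u, hu, h⟩, hw⟩)
    · split_ifs at h with h0
      exact ⟨u, hu, Or.inl ⟨h0, (Sum.inl.inj h).symm⟩⟩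
    · split_ifs at h with h0
      exact ⟨u, hu, Or.inr ⟨h0, Sum.inr.inj h ▸ hw⟩⟩
  · rintro ⟨u, hu, ⟨h0, rfl⟩ | ⟨h0, hw⟩⟩
    · exact Or.inl ⟨u, hu, if_pos h0⟩
    · exact Or.inr ⟨_, ⟨u, hu, if_neg h0⟩, hw⟩

/-- The code of the claim that program `c` with input `v` has output `w`. -/
def goalCode (c v w : ℕ) : ℕ := polyPair c (polyPair v w)

/-- The expression for `polyPair`. -/
def RegExpr.pair {K : ℕ} (p q : RegExpr K) : RegExpr K := .add (.mul (.add p q) (.add p q)) p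

/-- The expression for `polyCons`. -/
def RegExpr.cons {K : ℕ} (p q : RegExpr K) : RegExpr K := .add (p.pair q) (.const 1)

/-- The expression for `goalCode`. -/
def RegExpr.goal {K : ℕ} (c v w : RegExpr K) : RegExpr K := c.pair (v.pair w)

/-- Expressions for codes of programs. -/
def RegExpr.prog {K : ℕ} (d : ℕ) (p : RegExpr K) : RegExpr K := .add (.mul (.const 4) p) (.const d)

/-- The rules of the big-step semantics of programs.  A rule replaces its conclusion on top of a
stack of goals by its premises. -/
def evalRules : List (RegExpr 8 × RegExpr 8) :=
  let f := RegExpr.reg 1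
  let g := RegExpr.reg 2
  let v := RegExpr.reg 3
  let w := RegExpr.reg 4
  let u := RegExpr.reg 5
  let a := RegExpr.reg 6
  let nil := RegExpr.const 0
  let zero := RegExpr.const 0
  let one := RegExpr.const 1
  let rule (concl : RegExpr 8) (prems : List (RegExpr 8)) : RegExpr 8 × RegExpr 8 :=
    (concl.cons (.reg 7), prems.foldr .cons (.reg 7))
  -- Several constructs need separate rules for empty lists, since `headI` of the empty list is 0
  -- and its tail is empty, and for zero and successor heads.
  [rule (.goal (.const 0) v (zero.cons v)) [],
   rule (.goal (.const 1) nil (one.cons nil)) [],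
   rule (.goal (.const 1) (a.cons v) ((a.add one).cons nil)) [],
   rule (.goal (.const 2) nil nil) [],
   rule (.goal (.const 2) (a.cons v) v) [],
   rule (.goal (.prog 3 (f.pair g)) v (zero.cons w)) [.goal f v nil, .goal g v w],
   rule (.goal (.prog 3 (f.pair g)) v (a.cons w)) [.goal f v (a.cons u), .goal g v w],
   rule (.goal (.prog 4 (f.pair g)) v w) [.goal g v u, .goal f u w],
   rule (.goal (.prog 5 (f.pair g)) nil w) [.goal f nil w],
   rule (.goal (.prog 5 (f.pair g)) (zero.cons v) w) [.goal f v w],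
   rule (.goal (.prog 5 (f.pair g)) ((a.add one).cons v) w) [.goal g (a.cons v) w],
   rule (.goal (.prog 6 f) v nil) [.goal f v nil],
   rule (.goal (.prog 6 f) v w) [.goal f v (zero.cons w)],
   rule (.goal (.prog 6 f) v w) [.goal f v ((a.add one).cons u), .goal (.prog 6 f) u w]]

/-! ### Soundness of the rules -/

/-- The claim with a given code is true. -/
def GoalTrue (c : ℕ) : Prop :=
  decodeList (polyUnpair (polyUnpair c).2).2 ∈
    (decodeCode (polyUnpair c).1).eval (decodeList (polyUnpair (polyUnpair c).2).1)

theorem goalTrue_goalCode (c v w : ℕ) :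
    GoalTrue (goalCode c v w) ↔ decodeList w ∈ (decodeCode c).eval (decodeList v) := by
  simp [GoalTrue, goalCode]

/-- All claims on a stack are true. -/
def StackTrue (x : ℕ) : Prop := ∀ c ∈ decodeList x, GoalTrue c

theorem stackTrue_polyCons (c x : ℕ) : StackTrue (polyCons c x) ↔ GoalTrue c ∧ StackTrue x := by
  simp [StackTrue]

/-- Each rule is a valid inference, read from premises to conclusion. Guessed parameters are
arbitrary numbers; as the decoding functions are total, truth is meaningful for all of them. -/
theorem stackTrue_of_rule {r : RegExpr 8 × RegExpr 8} (hr : r ∈ evalRules) (e : Fin 8 → ℕ)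
    (h : StackTrue (r.2.eval e)) : StackTrue (r.1.eval e) := by
  have hpair (p q : RegExpr 8) : (p.pair q).eval e = polyPair (p.eval e) (q.eval e) := rfl
  have hcons (p q : RegExpr 8) : (p.cons q).eval e = polyCons (p.eval e) (q.eval e) := rfl
  have hgoal (c v w : RegExpr 8) :
      (RegExpr.goal c v w).eval e = goalCode (c.eval e) (v.eval e) (w.eval e) := rfl
  have hprog (d : ℕ) (p : RegExpr 8) : (RegExpr.prog d p).eval e = 4 * p.eval e + d := rfl
  have hadd (p q : RegExpr 8) : (p.add q).eval e = p.eval e + q.eval e := rfl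
  have hconst (d : ℕ) : (RegExpr.const d : RegExpr 8).eval e = d := rfl
  simp only [evalRules, List.mem_cons, List.not_mem_nil, or_false] at hr
  rcases hr with rfl | rfl | rfl | rfl | rfl | rfl | rfl | rfl | rfl | rfl | rfl | rfl | rfl | rfl <;>
  simp only [List.foldr, hpair, hcons, hgoal, hprog, hadd, hconst, stackTrue_polyCons,
    goalTrue_goalCode, decodeList_polyCons, decodeList_zero, decodeCode_zero, decodeCode_one,
    decodeCode_two, decodeCode_cons, decodeCode_comp, decodeCode_case, decodeCode_fix] at h ⊢
  · exact ⟨by simp, h⟩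
  · exact ⟨by simp, h⟩
  · exact ⟨by simp, h⟩
  · exact ⟨by simp, h⟩
  · exact ⟨by simp, h⟩
  · exact ⟨mem_eval_cons.2 ⟨_, h.1, _, h.2.1, rfl⟩, h.2.2⟩
  · exact ⟨mem_eval_cons.2 ⟨_, h.1, _, h.2.1, rfl⟩, h.2.2⟩
  · exact ⟨mem_eval_comp.2 ⟨_, h.1, h.2.1⟩, h.2.2⟩
  · simpa using h
  · simpa using h
  · simpa using h
  · exact ⟨mem_eval_fix.2 ⟨_, h.1, Or.inl ⟨rfl, rfl⟩⟩, h.2⟩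
  · exact ⟨mem_eval_fix.2 ⟨_, h.1, Or.inl ⟨rfl, rfl⟩⟩, h.2⟩
  · exact ⟨mem_eval_fix.2 ⟨_, h.1, Or.inr ⟨Nat.succ_ne_zero _, h.2.1⟩⟩, h.2.2⟩

/-- The empty stack is true, and truth passes backwards along each rewriting step. -/
theorem stackTrue_of_reach {x : ℕ} (h : Relation.ReflTransGen (RewriteStep evalRules) x 0) :
    StackTrue x := by
  induction h using Relation.ReflTransGen.head_induction_on with
  | refl => simp [StackTrue]
  | head h _ ih =>
    obtain ⟨r, hr, e, -, rfl, rfl⟩ := h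
    exact stackTrue_of_rule hr e ih

/-! ### Completeness of the rules -/

/-- A claim can be removed from the top of any stack. -/
def Derivable (c : ℕ) : Prop :=
  ∀ x, Relation.ReflTransGen (RewriteStep evalRules) (polyCons c x) x

/-- Here `e` gives the guesses for registers 1 to 6, and register 7 holds the rest of the stack.
After the rule fires, the premises `l` are removed in turn. -/
theorem derivable_of_rule (i : Fin 14) (e : Fin 6 → ℕ) {c : ℕ} (l : List ℕ)
    (h : ∀ x, (evalRules.get (i.cast rfl)).1.eval
        ![polyCons c x, e 0, e 1, e 2, e 3, e 4, e 5, x] = polyCons c x ∧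
      (evalRules.get (i.cast rfl)).2.eval
        ![polyCons c x, e 0, e 1, e 2, e 3, e 4, e 5, x] = l.foldr polyCons x)
    (hl : ∀ d ∈ l, Derivable d) : Derivable c := by
  intro x
  refine .head ⟨evalRules.get (i.cast rfl), List.get_mem _ _, _, rfl, h x⟩ ?_
  clear h
  induction l with
  | nil => exact .refl
  | cons d l ih =>
    exact (hl d List.mem_cons_self _).trans (ih fun d' hd' => hl d' (List.mem_cons_of_mem _ hd'))

/-- Structural induction on the program, with an inner induction on the iterations of a terminating
loop in the case of `fix`. -/
theorem derivable_of_mem_eval (c : Code) (v w : List ℕ) (h : w ∈ c.eval v) :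
    Derivable (goalCode (encodeCode c) (encodeList v) (encodeList w)) := by
  induction c generalizing v w with
  | zero' =>
    obtain rfl : w = 0 :: v := by simpa using h
    exact derivable_of_rule 0 ![0, 0, encodeList v, 0, 0, 0] [] (fun _ => ⟨rfl, rfl⟩) (by simp)
  | succ =>
    obtain rfl : w = [v.headI.succ] := by simpa using h
    cases v with
    | nil => exact derivable_of_rule 1 0 [] (fun _ => ⟨rfl, rfl⟩) (by simp)
    | cons a v =>
      exact derivable_of_rule 2 ![0, 0, encodeList v, 0, 0, a] [] (fun _ => ⟨rfl, rfl⟩) (by simp)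
  | tail =>
    obtain rfl : w = v.tail := by simpa using h
    cases v with
    | nil => exact derivable_of_rule 3 0 [] (fun _ => ⟨rfl, rfl⟩) (by simp)
    | cons a v =>
      exact derivable_of_rule 4 ![0, 0, encodeList v, 0, 0, a] [] (fun _ => ⟨rfl, rfl⟩) (by simp)
  | cons f g ihf ihg =>
    obtain ⟨u, hu, w, hw, rfl⟩ := mem_eval_cons.1 h
    cases u with
    | nil =>
      refine derivable_of_rule 5
        ![encodeCode f, encodeCode g, encodeList v, encodeList w, 0, 0]
        [goalCode (encodeCode f) (encodeList v) (encodeList []),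
          goalCode (encodeCode g) (encodeList v) (encodeList w)] (fun _ => ⟨rfl, rfl⟩) ?_
      simp [ihf _ _ hu, ihg _ _ hw]
    | cons a u =>
      refine derivable_of_rule 6
        ![encodeCode f, encodeCode g, encodeList v, encodeList w, encodeList u, a]
        [goalCode (encodeCode f) (encodeList v) (encodeList (a :: u)),
          goalCode (encodeCode g) (encodeList v) (encodeList w)] (fun _ => ⟨rfl, rfl⟩) ?_
      simp [ihf _ _ hu, ihg _ _ hw]
  | comp f g ihf ihg =>
    obtain ⟨u, hu, hw⟩ := mem_eval_comp.1 h
    refine derivable_of_rule 7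
      ![encodeCode f, encodeCode g, encodeList v, encodeList w, encodeList u, 0]
      [goalCode (encodeCode g) (encodeList v) (encodeList u),
        goalCode (encodeCode f) (encodeList u) (encodeList w)] (fun _ => ⟨rfl, rfl⟩) ?_
    simp [ihf _ _ hw, ihg _ _ hu]
  | case f g ihf ihg =>
    rw [Code.case_eval] at h
    rcases v with - | ⟨- | a, v⟩
    · refine derivable_of_rule 8 ![encodeCode f, encodeCode g, 0, encodeList w, 0, 0]
        [goalCode (encodeCode f) (encodeList []) (encodeList w)] (fun _ => ⟨rfl, rfl⟩) ?_
      simpa using ihf _ _ h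
    · refine derivable_of_rule 9 ![encodeCode f, encodeCode g, encodeList v, encodeList w, 0, 0]
        [goalCode (encodeCode f) (encodeList v) (encodeList w)] (fun _ => ⟨rfl, rfl⟩) ?_
      simpa using ihf _ _ h
    · refine derivable_of_rule 10 ![encodeCode f, encodeCode g, encodeList v, encodeList w, 0, a]
        [goalCode (encodeCode g) (encodeList (a :: v)) (encodeList w)] (fun _ => ⟨rfl, rfl⟩) ?_
      simpa using ihg _ _ h
  | fix f ih =>
    have h' := h
    rw [Code.fix_eval] at h'
    refine PFun.fixInduction (C := fun v => Derivable
      (goalCode (encodeCode (Code.fix f)) (encodeList v) (encodeList w))) h' fun v hv hrec => ?_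
    rw [← Code.fix_eval] at hv
    obtain ⟨u, hu, ⟨h0, rfl⟩ | ⟨h0, hw⟩⟩ := mem_eval_fix.1 hv
    · cases u with
      | nil =>
        refine derivable_of_rule 11 ![encodeCode f, 0, encodeList v, 0, 0, 0]
          [goalCode (encodeCode f) (encodeList v) (encodeList [])] (fun _ => ⟨rfl, rfl⟩) ?_
        simpa using ih _ _ hu
      | cons a w =>
        obtain rfl : a = 0 := h0
        refine derivable_of_rule 12 ![encodeCode f, 0, encodeList v, encodeList w, 0, 0]
          [goalCode (encodeCode f) (encodeList v) (encodeList (0 :: w))] (fun _ => ⟨rfl, rfl⟩) ?_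
        simpa using ih _ _ hu
    · rcases u with - | ⟨- | a, u⟩
      · exact absurd rfl h0
      · exact absurd rfl h0
      · refine derivable_of_rule 13
          ![encodeCode f, 0, encodeList v, encodeList w, encodeList u, a]
          [goalCode (encodeCode f) (encodeList v) (encodeList ((a + 1) :: u)),
            goalCode (encodeCode (Code.fix f)) (encodeList u) (encodeList w)]
          (fun _ => ⟨rfl, rfl⟩) ?_
        -- A nonzero head makes the body's output a continuation of the loop, so the inner induction
        -- hypothesis applies to its tail `u`.
        have := hrec u ((Part.mem_map_iff _).2 ⟨_, hu, if_neg h0⟩)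
        simpa using ⟨ih _ _ hu, this⟩

theorem reach_iff_mem_eval (c : Code) (v w : List ℕ) :
    Relation.ReflTransGen (RewriteStep evalRules)
        (encodeList [goalCode (encodeCode c) (encodeList v) (encodeList w)]) 0 ↔
      w ∈ c.eval v := by
  constructor
  · intro h
    have h1 := stackTrue_of_reach h _ (by rw [decodeList_encodeList]; exact List.mem_cons_self)
    simpa [goalTrue_goalCode] using h1
  · exact fun h => derivable_of_mem_eval c v w h 0

/-! ## Undecidability -/

/-- A program which halts on `[k]`, with output `[0]`, if and only if the partial recursive function
with Gödel number `k` is defined at `0`. -/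
theorem exists_halting_code : ∃ c : Code, ∀ k : ℕ,
    [0] ∈ c.eval [k] ↔ (Nat.Partrec.Code.eval (Denumerable.ofNat Nat.Partrec.Code k) 0).Dom := by
  have hf : Partrec fun k : ℕ =>
      -- Replacing the result by 0 turns halting into a claim whose output is known in advance.
      (Nat.Partrec.Code.eval (Denumerable.ofNat Nat.Partrec.Code k) 0).map fun _ => 0 :=
    (Nat.Partrec.Code.eval_part.comp (Computable.ofNat _) (Computable.const 0)).map
      (Computable.const 0).to₂
  obtain ⟨c, hc⟩ := Code.exists_code (Nat.Partrec'.part_iff₁.2 hf)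
  refine ⟨c, fun k => ?_⟩
  have h := hc (k ::ᵥ List.Vector.nil)
  change c.eval [k] = _ at h
  rw [h]
  simp [Part.dom_iff_mem]

/-- Reachability is undecidable for a class which contains all satisfiable real-valued basic action
theories whose action types have no time arguments. -/
theorem not_reachabilityDecidable {C : Set Theory}
    (hC : {D : Theory | D.IsBAT ∧ D.IsRealValued ∧ D.Satisfiable ∧ D.NoTimeArguments} ⊆ C) :
    ¬ ReachabilityDecidable C := by
  rintro ⟨f, hf, hdec⟩
  obtain ⟨c, hc⟩ := exists_halting_code
  -- The stack starts with the single claim that `c` maps `[k]` to `[0]`; the initial parameters are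
  -- irrelevant, since they can be guessed anew.
  let init : ℕ → Fin 8 → ℕ := fun k => Fin.cons
    (encodeList [goalCode (encodeCode c) (encodeList [k]) (encodeList [0])]) fun _ => 0
  have hpair : Primrec₂ polyPair := Primrec.nat_add.comp₂ (Primrec.nat_mul.comp₂ Primrec.nat_add
    Primrec.nat_add) Primrec₂.left
  have hcons : Primrec₂ polyCons := Primrec.succ.comp₂ hpair
  have hinit : ∀ j, Primrec fun k => init k j := by
    intro j
    cases j using Fin.cases with
    | zero =>
      exact hcons.comp (hpair.comp (Primrec.const _) (hpair.comp
        (hcons.comp Primrec.id (Primrec.const _)) (Primrec.const _))) (Primrec.const _)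
    | succ j => exact Primrec.const 0
  let P := rewriteMachine evalRules
  have hreach (k : ℕ) : f (instanceCode (machineTheory P (init k)) (regEq P 0 0)) = true ↔
      (Nat.Partrec.Code.eval (Denumerable.ofNat Nat.Partrec.Code k) 0).Dom := by
    have hmem : machineTheory P (init k) ∈ C :=
      hC ⟨machineTheory_isBAT _ _, List.cons_ne_nil _ _, ⟨_, isModel_machineModel _ _⟩,
        machineSig_time_args⟩
    refine (hdec _ hmem (regEq P 0 0)).trans ?_
    rw [machineTheory_reachable_iff, rewriteMachine_reach_iff, ← hc, ← reach_iff_mem_eval]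
    rfl
  refine ComputablePred.halting_problem 0 (ComputablePred.computable_iff.2
    ⟨fun d => f (instanceCode (machineTheory P (init (Encodable.encode d))) (regEq P 0 0)),
      hf.comp ((primrec_instanceCode_machineTheory P 0 hinit).to_comp.comp Computable.encode), ?_⟩)
  funext d
  rw [eq_iff_iff, hreach, Denumerable.ofNat_encode]

end SitCalc

theorem mainTheorem3 :
    ¬ SitCalc.ReachabilityDecidable {D | D.IsBAT ∧ D.IsRealValued} ∧
    ¬ SitCalc.ReachabilityDecidable
        {D | D.IsBAT ∧ D.IsRealValued ∧ D.Satisfiable ∧ D.NoTimeArguments} :=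
  ⟨SitCalc.not_reachabilityDecidable fun _ hD => ⟨hD.1, hD.2.1⟩,
    SitCalc.not_reachabilityDecidable subset_rfl⟩
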